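/- Let $q$ be a prime power with $q\neq 2$, let $\gamma$ be a primitive element of $\mathbb{F}_{q^2}$, and let $\mathcal{C}_{(1,q+1,q^2)}$ be the linear code over $\mathbb{F}_q$ of length $q+1$ consisting of the words \[ \left(\alpha+\mathrm{Tr}_{\mathbb{F}_{q^2}/\mathbb{F}_q}(\beta\gamma^{(q-1)i})\right)_{i=0}^{q},\qquad \alpha\in\mathbb{F}_q,\ \beta\in\mathbb{F}_{q^2}. \] Let $\mathcal{C}_{(1,q+1,q^2)}^{\perp}$ be its dual code with respect to the standard scalar product, and let $A_j^{\perp}$ be the number of its codewords of Hamming weight $j$. Then $\mathcal{C}_{(1,q+1,q^2)}^{\perp}$ is a cyclic code of length $q+1$, dimension $q-2$ and minimum Hamming distance $4$. It is optimal: its length meets the Griesmer bound, that is, $q+1=\sum_{i=0}^{q-3}\lceil 4/q^i\rceil$, and hence $q+1$ is the minimum length of a linear code over $\mathbb{F}_q$ of dimension $q-2$ and minimum distance $4$. Moreover \[ A_4^{\perp}=\frac{q(q^2-1)(q-1)(q-2)}{24}. \] In addition, if $q\geq 5$, then $\mathcal{C}_{(1,q+1,q^2)}^{\perp}$ is a $(q-2)$-weight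 code (exactly $q-2$ different nonzero weights occur among its codewords), and for $4\leq j\leq q+1$, \[ A_j^{\perp}=\frac{(q^2-1)\binom{q-1}{j-2}}{2j(j-1)q^2}\left[2(q-1)^{j-1}+(-1)^j\bigl((j-1)q((j-2)q-2)+2\bigr)\right]. \] -/

import Mathlib

open scoped Matrix

/-- The dual of a linear code `C` of length `n` over `K`, with respect to the standard
scalar product. -/
def dualCode {K : Type*} [Field K] {n : ℕ} (C : Submodule K (Fin n → K)) :
    Submodule K (Fin n → K) where
  carrier := {v | ∀ c ∈ C, v ⬝ᵥ c = 0}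
  zero_mem' := fun c _ => zero_dotProduct c
  add_mem' := fun {v w} hv hw c hc => by
    rw [add_dotProduct, hv c hc, hw c hc, add_zero]
  smul_mem' := fun a v hv c hc => by
    rw [smul_dotProduct, hv c hc, smul_zero]

/-- A linear code is cyclic if it contains, with each word `(c₀, …, cₙ₋₁)`, its cyclic shift
`(cₙ₋₁, c₀, …, cₙ₋₂)`. -/
def IsCyclicCode {K : Type*} [Field K] {n : ℕ} (C : Submodule K (Fin n → K)) : Prop :=
  ∀ c ∈ C, (fun i => c ((finRotate n).symm i)) ∈ C

/-- `d` is the minimum Hamming distance of `C`: it is the least distance between two distinct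
codewords (in particular `C` has at least two codewords). -/
def HasMinDistance {K : Type*} [Field K] [DecidableEq K] {n : ℕ}
    (C : Submodule K (Fin n → K)) (d : ℕ) : Prop :=
  IsLeast {e : ℕ | ∃ x ∈ C, ∃ y ∈ C, x ≠ y ∧ hammingDist x y = e} d

/-- A linear `[n, k, d]` code over `K`. -/
def IsLinearCode {K : Type*} [Field K] [DecidableEq K] {n : ℕ}
    (C : Submodule K (Fin n → K)) (k d : ℕ) : Prop :=
  Module.finrank K C = k ∧ HasMinDistance C d

/-- The number `A_j` of codewords of `C` of Hamming weight `j`. -/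
noncomputable def weightCount {K : Type*} [Field K] [DecidableEq K] {n : ℕ}
    (C : Submodule K (Fin n → K)) (j : ℕ) : ℕ :=
  {c : Fin n → K | c ∈ C ∧ hammingNorm c = j}.ncard

/-- `C` is an `M`-weight code: exactly `M` nonzero weights `1 ≤ i ≤ n` occur. -/
def IsMWeightCode {K : Type*} [Field K] [DecidableEq K] {n : ℕ}
    (C : Submodule K (Fin n → K)) (M : ℕ) : Prop :=
  {i : ℕ | 1 ≤ i ∧ i ≤ n ∧ weightCount C i ≠ 0}.ncard = M

/-- The Griesmer bound `∑_{i=0}^{k-1} ⌈d / q^i⌉`. -/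
def griesmerBound (q k d : ℕ) : ℕ :=
  ∑ i ∈ Finset.range k, ⌈(d : ℚ) / (q : ℚ) ^ i⌉₊

/-- `n = n_q(k, d)` for `q = |K|`: `n` is the minimum length of an `[n, k, d]` linear code
over `K`. -/
def IsMinLength (K : Type*) [Field K] [DecidableEq K] (k d n : ℕ) : Prop :=
  IsLeast {m : ℕ | ∃ C : Submodule K (Fin m → K), IsLinearCode C k d} n

/-- The length `(q² - 1) / gcd((q² - 1)/n₁, (q² - 1)/n₂)` of the code `C_(n₁, n₂, q²)`. -/
def reducibleLength (q n₁ n₂ : ℕ) : ℕ :=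
  (q ^ 2 - 1) / Nat.gcd ((q ^ 2 - 1) / n₁) ((q ^ 2 - 1) / n₂)

/-- The reducible cyclic code `C_(n₁, n₂, q²)` over `K = 𝔽_q`, where `L = 𝔽_{q²}` and `γ` is a
primitive element of `L`: the words `c(α, β)`, `α ∈ K`, `β ∈ L`, with entries
`α (γ^(q+1))^(((q-1)/n₁) i) + Tr_{L/K}(β γ^(((q²-1)/n₂) i))`. As `γ^(q+1)` lies in `L` (in the
image of `K`), the equation for the entries is written in `L`. -/
def reducibleCyclicCode (K : Type*) {L : Type*} [Field K] [Field L] [Algebra K L]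
    (γ : L) (q n₁ n₂ : ℕ) : Submodule K (Fin (reducibleLength q n₁ n₂) → K) where
  carrier := {c | ∃ (α : K) (β : L), ∀ i, algebraMap K L (c i) =
    algebraMap K L α * (γ ^ (q + 1)) ^ ((q - 1) / n₁ * (i : ℕ)) +
      algebraMap K L (Algebra.trace K L (β * γ ^ ((q ^ 2 - 1) / n₂ * (i : ℕ))))}
  zero_mem' := ⟨0, 0, fun i => by simp⟩
  add_mem' := by
    rintro c c' ⟨α, β, h⟩ ⟨α', β', h'⟩
    refine ⟨α + α', β + β', fun i => ?_⟩
    rw [Pi.add_apply, map_add, h i, h' i, add_mul, map_add, map_add, map_add]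
    ring
  smul_mem' := by
    rintro a c ⟨α, β, h⟩
    refine ⟨a * α, a • β, fun i => ?_⟩
    rw [Pi.smul_apply, smul_eq_mul, map_mul (algebraMap K L), h i, smul_mul_assoc, map_smul,
      smul_eq_mul, map_mul (algebraMap K L), map_mul (algebraMap K L)]
    ring

/-! If x is a power of δ = γ^(q-1), then x^(q+1) = 1, so x(α + Tr(βx)) = βx² + αx + β^q. This
quadratic has at most two roots unless α = β = 0. The q+1 powers of δ are distinct, so the code is
MDS of dimension 3 (`traceWord_zeros`). Hence exactly q^(|S|-3) dual words are supported inside a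
set S of at least 3 positions (`card_dualCode_supported`). Inversion over subsets shows that the
number with support exactly S depends only on |S| (`ncard_dualWordsWithSupport`), and A_j^⊥ is
C(q+1, j) times that number. It is 0 for sizes 1, 2, 3 and q-1 for size 4, whence distance 4; for q
≥ 5 it is positive from size 4 on (`mdsSupportCount_pos`). Minimality of the length follows from the
Singleton bound. -/

/-- Restriction of C to S is injective, so its transpose, from words on S to the dual space of C, is
surjective. The words counted are its kernel. -/
theorem card_dualCode_supported {K : Type*} [Field K] [Finite K] {n : ℕ}
    (C : Submodule K (Fin n → K)) (S : Finset (Fin n))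
    (hC : ∀ c ∈ C, (∀ i ∈ S, c i = 0) → c = 0) :
    Nat.card {v : Fin n → K // v ∈ dualCode C ∧ ∀ i ∉ S, v i = 0} =
      Nat.card K ^ (S.card - Module.finrank K C) := by
  classical
  let ψ : C →ₗ[K] (S → K) := LinearMap.funLeft K K (Subtype.val : S → Fin n) ∘ₗ C.subtype
  have hψ : Function.Injective ψ := by
    rw [injective_iff_map_eq_zero]
    intro c hc
    exact Subtype.ext (hC c c.2 fun i hi => congrFun hc ⟨i, hi⟩)
  let φ : (S → K) →ₗ[K] Module.Dual K C := ψ.dualMap ∘ₗ (dotProductEquiv K S).toLinearMap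
  have hφ : Function.Surjective φ :=
    (LinearMap.dualMap_surjective_of_injective hψ).comp (dotProductEquiv K S).surjective
  have hrank := LinearMap.finrank_range_add_finrank_ker φ
  rw [LinearMap.range_eq_top.2 hφ, finrank_top, Subspace.dual_finrank_eq,
    Module.finrank_fintype_fun_eq_card, Fintype.card_coe] at hrank
  have hker : Nat.card (LinearMap.ker φ) = Nat.card K ^ (S.card - Module.finrank K C) := by
    rw [Module.natCard_eq_pow_finrank (K := K)]
    congr 1
    omega
  rw [← hker]
  have hφ_apply (w : S → K) (c : C) : φ w c = ∑ i : S, w i * (c : Fin n → K) i := rfl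
  have hsum (v c : Fin n → K) (hv : ∀ i ∉ S, v i = 0) :
      ∑ i : S, v i * c i = v ⬝ᵥ c := by
    rw [dotProduct, Finset.sum_coe_sort S fun i => v i * c i]
    exact Finset.sum_subset (Finset.subset_univ S) fun i _ hi => by rw [hv i hi, zero_mul]
  refine Nat.card_congr
    { toFun := fun v => ⟨fun i => v.1 i, ?_⟩
      invFun := fun w => ⟨fun i => if h : i ∈ S then w.1 ⟨i, h⟩ else 0, ?_, ?_⟩
      left_inv := ?_
      right_inv := ?_ }
  · ext c
    rw [hφ_apply, hsum _ _ v.2.2]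
    exact v.2.1 c c.2
  · intro c hc
    rw [← hsum _ _ (fun i hi => dif_neg hi)]
    have := LinearMap.congr_fun (LinearMap.mem_ker.1 w.2) ⟨c, hc⟩
    rw [hφ_apply] at this
    simpa using this
  · intro i hi
    exact dif_neg hi
  · rintro ⟨v, hv, hvS⟩
    ext i
    by_cases h : i ∈ S
    · simp [h]
    · simp [h, hvS i h]
  · rintro ⟨w, hw⟩
    ext i
    simp

theorem finrank_dualCode {K : Type*} [Field K] [Finite K] {n : ℕ}
    (C : Submodule K (Fin n → K)) :
    Module.finrank K (dualCode C) = n - Module.finrank K C := by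
  have h := card_dualCode_supported C Finset.univ
    fun c _ hc => funext fun i => hc i (Finset.mem_univ i)
  have e : Nat.card {v : Fin n → K // v ∈ dualCode C ∧ ∀ i ∉ Finset.univ, v i = 0} =
      Nat.card (dualCode C) :=
    Nat.card_congr (Equiv.subtypeEquivRight fun v => by simp)
  rw [e, Module.natCard_eq_pow_finrank (K := K), Finset.card_univ, Fintype.card_fin] at h
  exact Nat.pow_right_injective Finite.one_lt_card h

/-! ### Inverting the subset sums -/

/-- The number of words with a given support of size `j` in an MDS code of redundancy `3`
over a field with `q` elements. -/
def mdsSupportCount (q : ℚ) (j : ℕ) : ℚ :=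
  ((q - 1) ^ j + (-1) ^ j * ((q ^ 3 - 1) - j * (q ^ 3 - q) +
    j * (j - 1) / 2 * (q ^ 3 - q ^ 2))) / q ^ 3

/-- Up to sign this is an s-th finite difference at 0 of a polynomial of degree below s. -/
theorem sum_choose_mul_neg_one_pow_mul_quadratic {s : ℕ} (hs : 3 ≤ s) (a b c : ℚ) :
    ∑ t ∈ Finset.range (s + 1), (s.choose t : ℚ) *
      ((-1) ^ t * (a + b * t + c * (t : ℚ) ^ 2)) = 0 := by
  let P : Polynomial ℚ := .C c * .X ^ 2 + .C b * .X + .C a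
  have hP : P.natDegree < s := lt_of_le_of_lt Polynomial.natDegree_quadratic_le hs
  have h := congrFun (Polynomial.fwdDiff_iter_eq_zero_of_degree_lt hP) 0
  rw [fwdDiff_iter_eq_sum_shift] at h
  have h2 : ∑ t ∈ Finset.range (s + 1), (s.choose t : ℚ) *
      ((-1) ^ t * (a + b * t + c * (t : ℚ) ^ 2)) = (-1) ^ s * 0 := by
    rw [Pi.zero_apply] at h
    rw [← h, Finset.mul_sum]
    refine Finset.sum_congr rfl fun t ht => ?_
    have hts : t ≤ s := Nat.lt_succ_iff.1 (Finset.mem_range.1 ht)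
    have hsign : (-1 : ℚ) ^ s * (-1) ^ (s - t) = (-1) ^ t := by
      obtain ⟨u, rfl⟩ := Nat.exists_eq_add_of_le hts
      rw [Nat.add_sub_cancel_left, pow_add, mul_assoc, ← mul_pow]
      simp
    simp only [P, zsmul_eq_mul, Int.cast_mul, Int.cast_pow, Int.cast_neg, Int.cast_one,
      Int.cast_natCast, zero_add, nsmul_eq_mul, mul_one, Polynomial.eval_add,
      Polynomial.eval_mul, Polynomial.eval_C, Polynomial.eval_pow, Polynomial.eval_X]
    rw [← hsign]
    ring
  rw [h2, mul_zero]

theorem sum_choose_mul_mdsSupportCount {q : ℚ} (hq : q ≠ 0) {s : ℕ} (hs : 3 ≤ s) :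
    ∑ t ∈ Finset.range (s + 1), (s.choose t : ℚ) * mdsSupportCount q t = q ^ (s - 3) := by
  have h1 : ∑ t ∈ Finset.range (s + 1), (s.choose t : ℚ) * (q - 1) ^ t = q ^ s := by
    have := add_pow (q - 1) 1 s
    rw [sub_add_cancel] at this
    rw [this]
    exact Finset.sum_congr rfl fun t _ => by rw [one_pow]; ring
  -- The coefficients come from expanding the alternating part of `mdsSupportCount` in powers of t.
  have h2 := sum_choose_mul_neg_one_pow_mul_quadratic hs (q ^ 3 - 1)
    (-(q ^ 3 - q) - (q ^ 3 - q ^ 2) / 2) ((q ^ 3 - q ^ 2) / 2)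
  have h3 : ∑ t ∈ Finset.range (s + 1), (s.choose t : ℚ) * mdsSupportCount q t =
      (q ^ s + 0) / q ^ 3 := by
    rw [← h1, ← h2, ← Finset.sum_add_distrib, Finset.sum_div]
    refine Finset.sum_congr rfl fun t _ => ?_
    rw [mdsSupportCount]
    ring
  rw [h3, add_zero, div_eq_iff (pow_ne_zero 3 hq), ← pow_add, Nat.sub_add_cancel hs]

/-! ### Support and weight distribution of the dual -/

section SupportCount

variable {K : Type*} [Field K] [DecidableEq K] {n : ℕ}

/-- The words of the dual code with support exactly `T`. -/
def dualWordsWithSupport (C : Submodule K (Fin n → K)) (T : Finset (Fin n)) :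
    Set (Fin n → K) :=
  {v | v ∈ dualCode C ∧ Finset.univ.filter (fun i => v i ≠ 0) = T}

theorem sum_powerset_ncard_dualWordsWithSupport [Finite K] (C : Submodule K (Fin n → K))
    (S : Finset (Fin n)) :
    ∑ T ∈ S.powerset, (dualWordsWithSupport C T).ncard =
      Nat.card {v : Fin n → K // v ∈ dualCode C ∧ ∀ i ∉ S, v i = 0} := by
  classical
  have := Fintype.ofFinite K
  have hN : Nat.card {v : Fin n → K // v ∈ dualCode C ∧ ∀ i ∉ S, v i = 0} =
      (Finset.univ.filter fun v : Fin n → K => v ∈ dualCode C ∧ ∀ i ∉ S, v i = 0).card := by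
    rw [Nat.card_eq_fintype_card, Fintype.card_subtype]
  rw [hN, Finset.card_eq_sum_card_fiberwise
    (f := fun v : Fin n → K => Finset.univ.filter fun i => v i ≠ 0) (t := S.powerset)]
  · refine Finset.sum_congr rfl fun T hT => ?_
    rw [← Set.ncard_coe_finset]
    congr 1
    ext v
    simp only [dualWordsWithSupport, Set.mem_ofPred_eq, Finset.coe_filter, Finset.mem_filter,
      Finset.mem_univ, true_and]
    constructor
    · rintro ⟨hv, rfl⟩
      refine ⟨⟨hv, fun i hi => ?_⟩, rfl⟩
      by_contra h
      exact hi (Finset.mem_powerset.1 hT (by simpa using h))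
    · rintro ⟨⟨hv, -⟩, h⟩
      exact ⟨hv, h⟩
  · intro v hv
    simp only [Finset.coe_filter, Finset.mem_univ, true_and, Set.mem_ofPred_eq] at hv
    refine Finset.mem_coe.2 (Finset.mem_powerset.2 fun i hi => ?_)
    by_contra h
    exact (Finset.mem_filter.1 hi).2 (hv.2 i h)

theorem ncard_dualWordsWithSupport_empty (C : Submodule K (Fin n → K)) :
    (dualWordsWithSupport C ∅).ncard = 1 := by
  rw [Set.ncard_eq_one]
  refine ⟨0, Set.ext fun v => ⟨fun h => ?_, ?_⟩⟩
  · funext i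
    simpa using Finset.filter_eq_empty_iff.1 h.2 (Finset.mem_univ i)
  · rintro rfl
    exact ⟨zero_mem _, by simp⟩

/-- The support distribution of the dual of a three-dimensional MDS code. -/
theorem ncard_dualWordsWithSupport [Finite K] (C : Submodule K (Fin n → K)) (hn : 3 ≤ n)
    (hdim : Module.finrank K C = 3)
    (hC : ∀ c ∈ C, ∀ S : Finset (Fin n), 3 ≤ S.card → (∀ i ∈ S, c i = 0) → c = 0)
    (S : Finset (Fin n)) :
    ((dualWordsWithSupport C S).ncard : ℚ) = mdsSupportCount (Nat.card K) S.card := by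
  have hq : (Nat.card K : ℚ) ≠ 0 := by exact_mod_cast Nat.card_pos.ne'
  have hcount (S : Finset (Fin n)) (hS : 3 ≤ S.card) :
      ∑ T ∈ S.powerset, (dualWordsWithSupport C T).ncard = Nat.card K ^ (S.card - 3) := by
    rw [sum_powerset_ncard_dualWordsWithSupport,
      card_dualCode_supported C S fun c hc h => hC c hc S hS h, hdim]
  -- Inside three positions there is only q^0 = 1 dual word, and the zero word already accounts for
  -- it.
  have hsmall (T : Finset (Fin n)) (hT : T.card ≤ 3) (hT0 : T ≠ ∅) :
      (dualWordsWithSupport C T).ncard = 0 := by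
    obtain ⟨S, hTS, hS⟩ := Finset.exists_superset_card_eq hT (by simpa using hn)
    have h := hcount S hS.ge
    rw [hS, Nat.sub_self, pow_zero,
      ← Finset.add_sum_erase _ _ (Finset.empty_mem_powerset S),
      ncard_dualWordsWithSupport_empty, Nat.add_eq_left, Finset.sum_eq_zero_iff] at h
    exact h T (Finset.mem_erase.2 ⟨hT0, Finset.mem_powerset.2 hTS⟩)
  induction S using Finset.strongInduction with
  | H S ih =>
    rcases Nat.lt_or_ge S.card 3 with hlt | hge
    · rcases S.eq_empty_or_nonempty with rfl | hne
      · rw [ncard_dualWordsWithSupport_empty, mdsSupportCount]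
        rw [eq_div_iff (pow_ne_zero 3 hq)]
        simp
      · rw [hsmall S hlt.le hne.ne_empty, mdsSupportCount]
        have hpos := hne.card_pos
        rw [Nat.cast_zero, eq_comm, div_eq_zero_iff]
        left
        interval_cases S.card <;> push_cast <;> ring
    · have h1 := hcount S hge
      have h2 := sum_choose_mul_mdsSupportCount hq hge
      have h3 := Finset.sum_powerset_apply_card (mdsSupportCount (Nat.card K)) (x := S)
      simp only [nsmul_eq_mul] at h3
      -- Both functions have the same sum over subsets of S; by induction they agree on proper
      -- subsets, so the terms at S agree.
      have h4 : ∑ T ∈ S.powerset, ((dualWordsWithSupport C T).ncard : ℚ) =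
          ∑ T ∈ S.powerset, mdsSupportCount (Nat.card K) T.card := by
        rw [h3, h2]
        exact_mod_cast h1
      rw [← Finset.add_sum_erase _ _ (Finset.mem_powerset_self S),
        ← Finset.add_sum_erase _ _ (Finset.mem_powerset_self S)] at h4
      rw [Finset.sum_congr rfl fun T hT => ih T ?_] at h4
      · exact add_right_cancel h4
      · obtain ⟨hne, hT⟩ := Finset.mem_erase.1 hT
        exact (Finset.mem_powerset.1 hT).ssubset_of_ne hne

theorem weightCount_dualCode_eq_sum [Finite K] (C : Submodule K (Fin n → K)) (j : ℕ) :
    weightCount (dualCode C) j =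
      ∑ T ∈ Finset.powersetCard j Finset.univ, (dualWordsWithSupport C T).ncard := by
  classical
  have := Fintype.ofFinite K
  have hN : weightCount (dualCode C) j =
      (Finset.univ.filter fun v : Fin n → K => v ∈ dualCode C ∧ hammingNorm v = j).card := by
    rw [weightCount, ← Set.ncard_coe_finset]
    simp
  rw [hN, Finset.card_eq_sum_card_fiberwise
    (f := fun v : Fin n → K => Finset.univ.filter fun i => v i ≠ 0)
    (t := Finset.powersetCard j Finset.univ)]
  · refine Finset.sum_congr rfl fun T hT => ?_
    rw [← Set.ncard_coe_finset]
    congr 1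
    ext v
    simp only [dualWordsWithSupport, Set.mem_ofPred_eq, Finset.coe_filter, Finset.mem_filter,
      Finset.mem_univ, true_and]
    refine Iff.symm ⟨?_, ?_⟩
    · rintro ⟨hv, rfl⟩
      exact ⟨⟨hv, (Finset.mem_powersetCard.1 hT).2⟩, rfl⟩
    · rintro ⟨⟨hv, -⟩, h⟩
      exact ⟨hv, h⟩
  · intro v hv
    simp only [Finset.coe_filter, Finset.mem_univ, true_and, Set.mem_ofPred_eq] at hv
    exact Finset.mem_coe.2 (Finset.mem_powersetCard.2 ⟨Finset.subset_univ _, hv.2⟩)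

theorem weightCount_dualCode [Finite K] (C : Submodule K (Fin n → K)) (hn : 3 ≤ n)
    (hdim : Module.finrank K C = 3)
    (hC : ∀ c ∈ C, ∀ S : Finset (Fin n), 3 ≤ S.card → (∀ i ∈ S, c i = 0) → c = 0) (j : ℕ) :
    (weightCount (dualCode C) j : ℚ) = n.choose j * mdsSupportCount (Nat.card K) j := by
  rw [weightCount_dualCode_eq_sum, Nat.cast_sum,
    Finset.sum_congr rfl fun T hT => (ncard_dualWordsWithSupport C hn hdim hC T).trans
      (congrArg _ (Finset.mem_powersetCard.1 hT).2),
    Finset.sum_const, Finset.card_powersetCard, Finset.card_univ, Fintype.card_fin, nsmul_eq_mul]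

end SupportCount

/-! ### The trace code -/

theorem reducibleLength_one_add_one {q : ℕ} (hq : 2 ≤ q) : reducibleLength q 1 (q + 1) = q + 1 := by
  have h : q ^ 2 - 1 = (q + 1) * (q - 1) := by
    simpa using Nat.sq_sub_sq q 1
  rw [reducibleLength, h, Nat.div_one, Nat.mul_div_cancel_left _ (by omega), Nat.gcd_mul_left_left,
    Nat.mul_div_cancel _ (by omega)]

section TraceCode

variable {K L : Type*} [Field K] [Field L] [Algebra K L] {n : ℕ}

/-- The words `(α + Tr(β δ^i))_i`, as a linear function of `(α, β)`. -/
noncomputable def traceWord (K : Type*) {L : Type*} [Field K] [Field L] [Algebra K L]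
    (n : ℕ) (δ : L) : K × L →ₗ[K] (Fin n → K) :=
  LinearMap.pi fun i => LinearMap.fst K K L +
    Algebra.trace K L ∘ₗ LinearMap.mulRight K (δ ^ (i : ℕ)) ∘ₗ LinearMap.snd K K L

theorem traceWord_apply (δ : L) (p : K × L) (i : Fin n) :
    traceWord K n δ p i = p.1 + Algebra.trace K L (p.2 * δ ^ (i : ℕ)) := rfl

theorem reducibleCyclicCode_eq_range_traceWord {q : ℕ} (γ : L) (hγ : γ ^ (q ^ 2 - 1) = 1)
    (hq : 2 ≤ q) :
    reducibleCyclicCode K γ q 1 (q + 1) =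
      LinearMap.range (traceWord K (reducibleLength q 1 (q + 1)) (γ ^ (q - 1))) := by
  have h : q ^ 2 - 1 = (q + 1) * (q - 1) := by
    simpa using Nat.sq_sub_sq q 1
  have hdiv : (q ^ 2 - 1) / (q + 1) = q - 1 := by
    rw [h, Nat.mul_div_cancel_left _ (by omega)]
  have hone (i : ℕ) : (γ ^ (q + 1)) ^ ((q - 1) * i) = 1 := by
    rw [← pow_mul, ← mul_assoc, ← h, pow_mul, hγ, one_pow]
  ext c
  change (∃ (α : K) (β : L), ∀ i, _) ↔ _
  simp only [Nat.div_one, hdiv, hone, mul_one, ← map_add,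
    (FaithfulSMul.algebraMap_injective K L).eq_iff, LinearMap.mem_range, Prod.exists]
  refine exists_congr fun α => exists_congr fun β => ?_
  rw [eq_comm, funext_iff]
  simp only [traceWord_apply, pow_mul]

theorem isCyclicCode_dualCode_of_forall_comp_mem (C : Submodule K (Fin n → K))
    (hC : ∀ c ∈ C, (fun i => c (finRotate n i)) ∈ C) : IsCyclicCode (dualCode C) := by
  intro v hv c hc
  have h := hv _ (hC c hc)
  rw [← h]
  simp only [dotProduct]
  rw [← Equiv.sum_comp (finRotate n)]
  simp only [Equiv.symm_apply_apply]

theorem isCyclicCode_dualCode_range_traceWord (δ : L) (hδ : δ ^ n = 1) :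
    IsCyclicCode (dualCode (LinearMap.range (traceWord K n δ))) := by
  refine isCyclicCode_dualCode_of_forall_comp_mem _ ?_
  rintro _ ⟨⟨α, β⟩, rfl⟩
  -- Rotation multiplies β by δ; the wrap-around at the last index uses δ^n = 1.
  refine ⟨(α, β * δ), funext fun i => ?_⟩
  rw [traceWord_apply, traceWord_apply, mul_assoc, ← pow_succ']
  obtain _ | n := n
  · exact i.elim0
  congr 3
  rw [coe_finRotate]
  split_ifs with h
  · rw [h, Fin.val_last, hδ, pow_zero]
  · rfl

theorem traceWord_zeros [Finite K] (hL : Module.finrank K L = 2) {δ : L}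
    (hδ : IsPrimitiveRoot δ (Nat.card K + 1)) (p : K × L)
    (S : Finset (Fin (Nat.card K + 1))) (hS : 3 ≤ S.card)
    (hp : ∀ i ∈ S, traceWord K (Nat.card K + 1) δ p i = 0) : p = 0 := by
  classical
  obtain ⟨α, β⟩ := p
  have : Module.Finite K L := Module.finite_of_finrank_eq_succ hL
  have : Finite L := Module.finite_of_finite K
  let P : Polynomial L := .C β * .X ^ 2 + .C (algebraMap K L α) * .X + .C (β ^ Nat.card K)
  have hroot (i) (hi : i ∈ S) : P.eval (δ ^ (i : ℕ)) = 0 := by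
    have h := congrArg (algebraMap K L) (hp i hi)
    rw [traceWord_apply, map_add, map_zero, FiniteField.algebraMap_trace_eq_sum_pow, hL,
      Finset.sum_range_succ, Finset.sum_range_one, pow_zero, pow_one, pow_one, mul_pow] at h
    have hx : (δ ^ (i : ℕ)) ^ Nat.card K * δ ^ (i : ℕ) = 1 := by
      rw [← pow_succ, ← pow_mul, mul_comm, pow_mul, hδ.pow_eq_one, one_pow]
    simp only [P, Polynomial.eval_add, Polynomial.eval_mul, Polynomial.eval_C,
      Polynomial.eval_pow, Polynomial.eval_X]
    -- With x = δ^i, multiply α + βx + β^q x^q = 0 by x and replace x^(q+1) by 1.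
    linear_combination δ ^ (i : ℕ) * h - β ^ Nat.card K * hx
  have hP : P = 0 := by
    refine Polynomial.eq_zero_of_natDegree_lt_card_of_eval_eq_zero' P
      (S.image fun i : Fin (Nat.card K + 1) => δ ^ (i : ℕ)) ?_ ?_
    · simpa using hroot
    · rw [Finset.card_image_of_injective]
      · exact lt_of_le_of_lt Polynomial.natDegree_quadratic_le hS
      · intro i j hij
        exact Fin.ext (hδ.pow_inj i.2 j.2 hij)
  have h2 : P.coeff 2 = β := by simp [P, -map_pow]
  have h1 : P.coeff 1 = algebraMap K L α := by simp [P, -map_pow, Polynomial.coeff_C]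
  rw [hP, Polynomial.coeff_zero] at h1 h2
  have hα : α = 0 := (FaithfulSMul.algebraMap_injective K L) (by rw [← h1, map_zero])
  rw [hα, ← h2]
  rfl

theorem finrank_range_traceWord [Finite K] (hL : Module.finrank K L = 2) {δ : L}
    (hδ : IsPrimitiveRoot δ (Nat.card K + 1)) :
    Module.finrank K (LinearMap.range (traceWord K (Nat.card K + 1) δ)) = 3 := by
  have : Module.Finite K L := Module.finite_of_finrank_eq_succ hL
  have hK : 1 < Nat.card K := Finite.one_lt_card
  rw [LinearMap.finrank_range_of_inj, Module.finrank_prod, hL, Module.finrank_self]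
  rw [injective_iff_map_eq_zero]
  intro p hp
  exact traceWord_zeros hL hδ p Finset.univ (by simpa using by omega)
    fun i _ => congrFun hp i

end TraceCode

/-! ### Griesmer and Singleton bounds, minimum distance -/

theorem griesmerBound_sub_two_four {q : ℕ} (hq : 3 ≤ q) : griesmerBound q (q - 2) 4 = q + 1 := by
  obtain ⟨m, rfl⟩ := Nat.exists_eq_add_of_le hq
  rw [griesmerBound, show 3 + m - 2 = m + 1 by omega, Finset.sum_range_succ']
  have h4 : ⌈((4 : ℕ) : ℚ) / ((3 + m : ℕ) : ℚ) ^ 0⌉₊ = 4 := by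
    rw [pow_zero, div_one, Nat.ceil_natCast]
  rw [h4, Finset.sum_congr rfl fun i hi => show _ = 1 from ?_]
  · simp
    omega
  · have hi := Finset.mem_range.1 hi
    -- An index i < m exists only if m ≥ 1, so here q ≥ 4.
    have hle : 4 ≤ (3 + m) ^ (i + 1) :=
      (show 4 ≤ 3 + m by omega).trans (Nat.le_self_pow (by omega) _)
    rw [Nat.ceil_eq_iff one_ne_zero]
    have hle' : ((4 : ℕ) : ℚ) ≤ ((3 + m : ℕ) : ℚ) ^ (i + 1) := by exact_mod_cast hle
    have hpos : (0 : ℚ) < ((3 + m : ℕ) : ℚ) ^ (i + 1) := lt_of_lt_of_le (by norm_num) hle'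
    constructor
    · rw [Nat.sub_self, Nat.cast_zero]
      exact div_pos (by norm_num) hpos
    · rw [Nat.cast_one]
      exact (div_le_one hpos).2 hle'

/-- The Singleton bound. -/
theorem IsLinearCode.add_le_length_add_one {K : Type*} [Field K] [DecidableEq K] {n k d : ℕ}
    {C : Submodule K (Fin n → K)} (h : IsLinearCode C k d) : k + d ≤ n + 1 := by
  obtain ⟨hk, ⟨x, -, y, -, hxy, hd⟩, hmin⟩ := h
  have hdn : d ≤ n := by
    rw [← hd]
    simpa using hammingDist_le_card_fintype (x := x) (y := y)
  have hd0 : 0 < d := by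
    rw [← hd]
    exact hammingDist_pos.2 hxy
  -- Deleting the last d-1 coordinates cannot identify two codewords at distance at least d.
  let f : C →ₗ[K] (Fin (n - (d - 1)) → K) :=
    LinearMap.funLeft K K (Fin.castLE (Nat.sub_le n (d - 1))) ∘ₗ C.subtype
  have hf : Function.Injective f := by
    intro a b hab
    by_contra hne
    have hda : d ≤ hammingDist (a : Fin n → K) b :=
      hmin ⟨a, a.2, b, b.2, fun h => hne (Subtype.ext h), rfl⟩
    have hsub : (Finset.univ.filter fun i => (a : Fin n → K) i ≠ (b : Fin n → K) i) ⊆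
        Finset.univ \ Finset.univ.map (Fin.castLEEmb (Nat.sub_le n (d - 1))) := by
      intro i hi
      rw [Finset.mem_sdiff, Finset.mem_map]
      refine ⟨Finset.mem_univ i, ?_⟩
      rintro ⟨j, -, rfl⟩
      exact (Finset.mem_filter.1 hi).2 (congrFun hab j)
    have hcard := Finset.card_le_card hsub
    rw [Finset.card_sdiff_of_subset (Finset.subset_univ _), Finset.card_map, Finset.card_univ,
      Finset.card_univ, Fintype.card_fin, Fintype.card_fin] at hcard
    change hammingDist (a : Fin n → K) b ≤ _ at hcard
    omega
  have := LinearMap.finrank_le_finrank_of_injective hf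
  rw [hk, Module.finrank_fintype_fun_eq_card, Fintype.card_fin] at this
  omega

theorem hasMinDistance_of_weightCount {K : Type*} [Field K] [Finite K] [DecidableEq K] {n : ℕ}
    {C : Submodule K (Fin n → K)} {d : ℕ} (hd0 : d ≠ 0) (hd : weightCount C d ≠ 0)
    (hlt : ∀ j, 0 < j → j < d → weightCount C j = 0) : HasMinDistance C d := by
  constructor
  · obtain ⟨c, hc, hcd⟩ := Set.nonempty_of_ncard_ne_zero hd
    refine ⟨c, hc, 0, zero_mem C, ?_, by rw [hammingDist_zero_right, hcd]⟩
    rintro rfl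
    exact hd0 (by rw [← hcd, hammingNorm_zero])
  · rintro _ ⟨x, hx, y, hy, hxy, rfl⟩
    by_contra h
    have h0 := hlt _ (hammingDist_pos.2 hxy) (not_le.1 h)
    rw [weightCount, Set.ncard_eq_zero (Set.toFinite _)] at h0
    refine Set.notMem_empty (-x + y) ?_
    rw [← h0]
    exact ⟨add_mem (neg_mem hx) hy, (hammingDist_eq_hammingNorm x y).symm⟩

/-! ### Positivity and closed forms of the counts -/

/-- With u = q-1, this makes the power of q-1 dominate when the alternating term is negative. From m
to m+1 the left side grows by (m+1)/(m-1) ≤ 4 ≤ u. -/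
theorem mul_sub_one_mul_sq_lt_two_mul_pow {u : ℚ} (hu : 4 ≤ u) {m : ℕ} (hm : 4 ≤ m) :
    m * (m - 1) * (u + 1) ^ 2 < 2 * u ^ m := by
  induction m, hm using Nat.le_induction with
  | base => norm_num; nlinarith [mul_self_nonneg (u ^ 2 - 16), mul_self_nonneg (u - 4)]
  | succ m hm ih =>
    have hm' : (4 : ℚ) ≤ m := by exact_mod_cast hm
    have h0 : 0 ≤ (m : ℚ) * (u + 1) ^ 2 := by positivity
    have h1 : 0 < u ^ m := by positivity
    push_cast
    calc ((m : ℚ) + 1) * (m + 1 - 1) * (u + 1) ^ 2 = m * (u + 1) ^ 2 * (m + 1) := by ring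
      _ ≤ m * (u + 1) ^ 2 * (4 * (m - 1)) := mul_le_mul_of_nonneg_left (by linarith) h0
      _ = 4 * (m * (m - 1) * (u + 1) ^ 2) := by ring
      _ < 4 * (2 * u ^ m) := by linarith
      _ ≤ u * (2 * u ^ m) := mul_le_mul_of_nonneg_right hu (by positivity)
      _ = 2 * u ^ (m + 1) := by ring

theorem mdsSupportCount_succ {q : ℚ} (m : ℕ) :
    mdsSupportCount q (m + 1) = (q - 1) / (2 * q ^ 3) * (2 * (q - 1) ^ m +
      (-1) ^ (m + 1) * (m * q * ((m - 1) * q - 2) + 2)) := by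
  rw [mdsSupportCount]
  push_cast
  ring

theorem mdsSupportCount_one (q : ℚ) : mdsSupportCount q 1 = 0 := by
  rw [mdsSupportCount]; push_cast; ring

theorem mdsSupportCount_two (q : ℚ) : mdsSupportCount q 2 = 0 := by
  rw [mdsSupportCount]; push_cast; ring

theorem mdsSupportCount_three (q : ℚ) : mdsSupportCount q 3 = 0 := by
  rw [mdsSupportCount]; push_cast; ring

theorem mdsSupportCount_four {q : ℚ} (hq : q ≠ 0) : mdsSupportCount q 4 = q - 1 := by
  rw [mdsSupportCount, div_eq_iff (pow_ne_zero 3 hq)]; push_cast; ring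

/-- The bound on q is sharp: for q = 4 and j = 5 the count is 0. -/
theorem mdsSupportCount_pos {q : ℚ} (hq : 5 ≤ q) {j : ℕ} (hj : 4 ≤ j) :
    0 < mdsSupportCount q j := by
  obtain rfl | hj := hj.eq_or_lt
  · rw [mdsSupportCount_four (by positivity)]
    linarith
  obtain ⟨m, rfl⟩ : ∃ m, j = m + 1 := ⟨j - 1, by omega⟩
  have hm : 4 ≤ m := by omega
  have hm' : (4 : ℚ) ≤ m := by exact_mod_cast hm
  have key := mul_sub_one_mul_sq_lt_two_mul_pow (u := q - 1) (by linarith) hm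
  rw [sub_add_cancel] at key
  have hmq : 4 * 5 ≤ (m : ℚ) * q := mul_le_mul hm' hq (by norm_num) (by positivity)
  have hfac : 0 ≤ (m : ℚ) * q * ((m - 1) * q - 2) :=
    mul_nonneg (by positivity) (by nlinarith)
  rw [mdsSupportCount_succ]
  refine mul_pos (div_pos (by linarith) (by positivity)) ?_
  rcases neg_one_pow_eq_or ℚ (m + 1) with h | h <;> rw [h]
  · have : 0 ≤ (q - 1) ^ m := pow_nonneg (by linarith) m
    linarith
  · linarith

/-- Absorption applied twice gives C(q+1, j) = (q+1)q/(j(j-1)) · C(q-1, j-2). -/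
theorem choose_mul_mdsSupportCount {q j : ℕ} (hq : 1 ≤ q) (hj : 2 ≤ j) :
    ((q + 1).choose j : ℚ) * mdsSupportCount q j =
      ((q : ℚ) ^ 2 - 1) * ((q - 1).choose (j - 2) : ℚ) /
          (2 * (j : ℚ) * ((j : ℚ) - 1) * (q : ℚ) ^ 2) *
        (2 * ((q : ℚ) - 1) ^ (j - 1) +
          (-1 : ℚ) ^ j *
            (((j : ℚ) - 1) * (q : ℚ) * (((j : ℚ) - 2) * (q : ℚ) - 2) + 2)) := by
  obtain ⟨p, rfl⟩ := Nat.exists_eq_add_of_le' hq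
  obtain ⟨i, rfl⟩ := Nat.exists_eq_add_of_le' hj
  have h1 : ((p + 1 + 1 : ℕ) : ℚ) * ((p + 1).choose (i + 1) : ℚ) =
      ((p + 1 + 1).choose (i + 2) : ℚ) * ((i + 2 : ℕ) : ℚ) := by
    exact_mod_cast Nat.add_one_mul_choose_eq (p + 1) (i + 1)
  have h2 : ((p + 1 : ℕ) : ℚ) * (p.choose i : ℚ) =
      ((p + 1).choose (i + 1) : ℚ) * ((i + 1 : ℕ) : ℚ) := by
    exact_mod_cast Nat.add_one_mul_choose_eq p i
  rw [mdsSupportCount_succ]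
  simp only [Nat.add_sub_cancel, show i + 2 - 1 = i + 1 by omega]
  push_cast at h1 h2 ⊢
  have hi1 : (i : ℚ) + 1 ≠ 0 := by positivity
  have hi2 : (i : ℚ) + 2 ≠ 0 := by positivity
  have hp : (p : ℚ) + 1 ≠ 0 := by positivity
  have hch : ((p + 1 + 1).choose (i + 2) : ℚ) =
      (p + 1 + 1) * ((p + 1) * p.choose i / (i + 1)) / (i + 2) := by
    rw [eq_div_iff hi2, ← h1, h2, mul_div_cancel_right₀ _ hi1]
  rw [hch, show (i : ℚ) + 2 - 1 = i + 1 by ring, show (i : ℚ) + 2 - 2 = i + 1 - 1 by ring]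
  generalize (2 * ((p : ℚ) + 1 - 1) ^ (i + 1) + (-1) ^ (i + 1 + 1) *
    ((i + 1) * (p + 1) * ((i + 1 - 1) * (p + 1) - 2) + 2)) = B
  field_simp
  ring

theorem choose_four_mul_mdsSupportCount {q : ℕ} (hq : 2 ≤ q) :
    ((q + 1).choose 4 : ℚ) * mdsSupportCount q 4 =
      (q : ℚ) * ((q : ℚ) ^ 2 - 1) * ((q : ℚ) - 1) * ((q : ℚ) - 2) / 24 := by
  have hq0 : (q : ℚ) ≠ 0 := by positivity
  rw [mdsSupportCount_four hq0, Nat.cast_choose_eq_descPochhammer_div]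
  simp [descPochhammer_succ_right, Nat.factorial]
  ring

theorem isMWeightCode_of_weightCount {K : Type*} [Field K] [Finite K] [DecidableEq K] {n d : ℕ}
    {C : Submodule K (Fin n → K)} (hd : 1 ≤ d)
    (hC : ∀ j, 1 ≤ j → j ≤ n → (weightCount C j ≠ 0 ↔ d ≤ j)) :
    IsMWeightCode C (n + 1 - d) := by
  have h : {i : ℕ | 1 ≤ i ∧ i ≤ n ∧ weightCount C i ≠ 0} = ↑(Finset.Icc d n) := by
    ext i
    rw [Finset.coe_Icc]
    change (_ ∧ _ ∧ _) ↔ (_ ∧ _)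
    constructor
    · rintro ⟨h1, h2, h3⟩
      exact ⟨(hC i h1 h2).1 h3, h2⟩
    · rintro ⟨h1, h2⟩
      exact ⟨hd.trans h1, h2, (hC i (hd.trans h1) h2).2 h1⟩
  rw [IsMWeightCode, h, Set.ncard_coe_finset, Nat.card_Icc]

/-! ### The main theorem -/

theorem theorem4 {K L : Type*} [Field K] [Finite K] [DecidableEq K] [Field L] [Algebra K L]
    (q : ℕ) (hq : Nat.card K = q) (hL : Module.finrank K L = 2)
    (γ : L) (hγ : IsPrimitiveRoot γ (q ^ 2 - 1)) (hq2 : q ≠ 2) :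
    reducibleLength q 1 (q + 1) = q + 1 ∧
    IsCyclicCode (dualCode (reducibleCyclicCode K γ q 1 (q + 1))) ∧
    IsLinearCode (dualCode (reducibleCyclicCode K γ q 1 (q + 1))) (q - 2) 4 ∧
    q + 1 = griesmerBound q (q - 2) 4 ∧
    IsMinLength K (q - 2) 4 (q + 1) ∧
    (weightCount (dualCode (reducibleCyclicCode K γ q 1 (q + 1))) 4 : ℚ) =
      (q : ℚ) * ((q : ℚ) ^ 2 - 1) * ((q : ℚ) - 1) * ((q : ℚ) - 2) / 24 ∧
    (5 ≤ q →
      IsMWeightCode (dualCode (reducibleCyclicCode K γ q 1 (q + 1))) (q - 2) ∧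
      ∀ j : ℕ, 4 ≤ j → j ≤ q + 1 →
        (weightCount (dualCode (reducibleCyclicCode K γ q 1 (q + 1))) j : ℚ) =
          ((q : ℚ) ^ 2 - 1) * ((q - 1).choose (j - 2) : ℚ) /
              (2 * (j : ℚ) * ((j : ℚ) - 1) * (q : ℚ) ^ 2) *
            (2 * ((q : ℚ) - 1) ^ (j - 1) +
              (-1 : ℚ) ^ j *
                (((j : ℚ) - 1) * (q : ℚ) * (((j : ℚ) - 2) * (q : ℚ) - 2) + 2))) := by
  have hq1 : 1 < q := by
    rw [← hq]
    exact Finite.one_lt_card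
  have hq3 : 3 ≤ q := by omega
  have hn := reducibleLength_one_add_one (q := q) (by omega)
  rw [reducibleCyclicCode_eq_range_traceWord γ hγ.pow_eq_one (by omega)]
  have hδ : IsPrimitiveRoot (γ ^ (q - 1)) (q + 1) := by
    have h : q ^ 2 - 1 = (q - 1) * (q + 1) := by
      rw [mul_comm]
      simpa using Nat.sq_sub_sq q 1
    exact hγ.pow (by rw [h]; exact Nat.mul_pos (by omega) (by omega)) h
  refine ⟨hn, ?_⟩
  -- From here on only the order q+1 of δ = γ^(q-1) matters.
  revert hδ
  generalize γ ^ (q - 1) = δ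
  rw [hn]
  intro hδ
  subst hq
  have hq0 : (Nat.card K : ℚ) ≠ 0 := by positivity
  have hdim := finrank_range_traceWord hL hδ
  have hw := weightCount_dualCode (LinearMap.range (traceWord K (Nat.card K + 1) δ))
    (by omega) hdim (by
      rintro _ ⟨p, rfl⟩ S hS hp
      rw [traceWord_zeros hL hδ p S hS hp, map_zero])
  have hsmall (j : ℕ) (h0 : 0 < j) (h4 : j < 4) :
      weightCount (dualCode (LinearMap.range (traceWord K (Nat.card K + 1) δ))) j = 0 := by
    have h := hw j
    interval_cases j
    · rw [mdsSupportCount_one, mul_zero] at h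
      exact_mod_cast h
    · rw [mdsSupportCount_two, mul_zero] at h
      exact_mod_cast h
    · rw [mdsSupportCount_three, mul_zero] at h
      exact_mod_cast h
  have hfour : weightCount (dualCode (LinearMap.range (traceWord K (Nat.card K + 1) δ))) 4 ≠ 0 := by
    have h : (Nat.card K + 1).choose 4 ≠ 0 := (Nat.choose_pos (by omega)).ne'
    have h' : (Nat.card K : ℚ) - 1 ≠ 0 := sub_ne_zero.2 (by exact_mod_cast hq1.ne')
    rw [← Nat.cast_ne_zero (R := ℚ), hw, mdsSupportCount_four hq0]
    exact mul_ne_zero (by exact_mod_cast h) h'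
  have hcode : IsLinearCode (dualCode (LinearMap.range (traceWord K (Nat.card K + 1) δ)))
      (Nat.card K - 2) 4 :=
    ⟨by rw [finrank_dualCode, hdim]; omega,
      hasMinDistance_of_weightCount (by norm_num) hfour hsmall⟩
  refine ⟨isCyclicCode_dualCode_range_traceWord δ hδ.pow_eq_one, hcode,
    (griesmerBound_sub_two_four hq3).symm, ⟨⟨_, hcode⟩, ?_⟩, ?_, fun hq5 => ⟨?_, ?_⟩⟩
  · rintro m ⟨C, hC⟩
    have := hC.add_le_length_add_one
    omega
  · rw [hw, choose_four_mul_mdsSupportCount (by omega)]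
  · have h := isMWeightCode_of_weightCount (d := 4)
      (C := dualCode (LinearMap.range (traceWord K (Nat.card K + 1) δ))) (by norm_num)
      fun j h1 hj => ⟨fun h => by_contra fun h4 => h (hsmall j h1 (not_le.1 h4)), fun h4 => by
        rw [← Nat.cast_ne_zero (R := ℚ), hw]
        exact mul_ne_zero (by exact_mod_cast (Nat.choose_pos hj).ne')
          (mdsSupportCount_pos (by exact_mod_cast hq5) h4).ne'⟩
    rwa [show Nat.card K + 1 + 1 - 4 = Nat.card K - 2 by omega] at h
  · intro j h4 _
    rw [hw, choose_mul_mdsSupportCount (by omega) (by omega)]
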